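/- Let $G$ be a connected finite simple graph of order $n$ (so $n\ge 1$). Let $s^+(G)$ denote the sum of the squares of the positive eigenvalues, counted with multiplicity, of the adjacency matrix of $G$, and let $\gamma(G)$ be the domination number of $G$, i.e. the minimum size of a set $D\subseteq V(G)$ such that every vertex outside $D$ has a neighbour in $D$. Call a vertex dominating if it is adjacent to all other vertices. (i) If $G$ has a dominating vertex and $G$ is not isomorphic to the star $K_{1,n-1}$ (where $K_{1,0}=K_1$), then $s^+(G)\ge n$. (ii) If $\gamma(G)\le 2$, then $s^+(G)\ge n-1$. -/

import Mathlib

namespace SimpleGraph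

variable {V : Type*}

/-- A vertex adjacent to every other vertex. -/
def IsDominatingVertex (G : SimpleGraph V) (v : V) : Prop :=
  ∀ w, w ≠ v → G.Adj v w

/-- A set of vertices such that every vertex outside it has a neighbour in it. -/
def IsDominatingSet (G : SimpleGraph V) (D : Finset V) : Prop :=
  ∀ w, w ∉ D → ∃ v ∈ D, G.Adj v w

/-- The domination number `γ(G)` of a finite graph: the least size of a dominating set
(the whole vertex set is dominating, so the infimum is attained). -/
noncomputable def dominationNumber [Fintype V] (G : SimpleGraph V) : ℕ :=
  sInf {k | ∃ D : Finset V, G.IsDominatingSet D ∧ D.card = k}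

/-- The positive square energy `s⁺(G)`: the sum of the squares of the positive eigenvalues of the
adjacency matrix, counted with multiplicity. -/
noncomputable def posSquareEnergy [Fintype V] [DecidableEq V] (G : SimpleGraph V)
    [DecidableRel G.Adj] : ℝ :=
  ∑ i : V with 0 < (G.isHermitian_adjMatrix ℝ).eigenvalues i,
    (G.isHermitian_adjMatrix ℝ).eigenvalues i ^ 2

end SimpleGraph

/-!
For a real symmetric matrix `A`, the sum of the squares of the positive eigenvalues is the maximum
of `2 tr(AX) - tr(X²)` over positive semidefinite `X`. Hence every such `X` certifies a lower bound
for `s⁺(G)`, and `s⁺` is superadditive over disjoint induced subgraphs. The spectrum of a bipartite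
graph is symmetric, so an induced bipartite subgraph with `e` edges contributes at least `e`.

If a dominating vertex `v` has two adjacent neighbours `x` and `y`, take for `X` the positive part
of the star at `v`, which certifies `deg v = n - 1`, and add a multiple of `wwᵀ` with
`w = 1_x + 1_y`. The edges among the leaves make up the missing `1`.

Suppose now that `{u, v}` is dominating and neither vertex dominates alone. If the neighbourhood `U`
of `u` outside `v` spans an edge, split the graph into `{u} ∪ U`, to which the previous case
applies, and the rest, dominated by `v`. Otherwise `U` and its analogue `W` for `v` are independent.
Let `p = |U \ W|`, `q = |W \ U|`, `r = |U ∩ W|` and let `e` be the number of edges between `U` and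
`W`, so `n = p + q + r + 2`; if `u` and `v` are not adjacent, connectedness gives `r + e ≥ 1`. The
bipartite graph between `{v} ∪ (U \ W)` and `{u} ∪ (W \ U)` certifies `[u ~ v] + p + q + e`, which
is good for large `e`. For `e ≤ r` use the positive part of the graph of all edges from `{u, v}` to
`U ∪ W`: by itself it certifies `p + q + 2r`, and the `e` extra edges cost at most `r / 2`. This
suffices for `r ≥ 2`, and the case `r = e = 1` is repaired by adding a multiple of `wwᵀ` as above.
-/

namespace PositiveSquareEnergy

open Finset Matrix SimpleGraph

section Gain

variable {n m : Type*} [Fintype n] [Fintype m]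

/-- The concave quadratic functional `X ↦ 2 tr(AX) - tr(X²)`. Its maximum over positive semidefinite
`X` is the sum of the squares of the positive eigenvalues of `A`, so every such `X` certifies a
lower bound for that sum. -/
noncomputable def gain (A X : Matrix n n ℝ) : ℝ :=
  2 * (A * X).trace - (X * X).trace

theorem gain_add (A X Y : Matrix n n ℝ) :
    gain A (X + Y) = gain A X + gain A Y - 2 * (X * Y).trace := by
  simp only [gain, Matrix.mul_add, Matrix.add_mul, trace_add, trace_mul_comm Y X]
  ring

theorem trace_mul_vecMulVec (A : Matrix n n ℝ) (v w : n → ℝ) :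
    (A * vecMulVec v w).trace = w ⬝ᵥ A *ᵥ v := by
  rw [mul_vecMulVec, trace_vecMulVec, dotProduct_comm]

theorem gain_smul_vecMulVec (A : Matrix n n ℝ) (c : ℝ) (w : n → ℝ) :
    gain A (c • vecMulVec w w) = 2 * c * (w ⬝ᵥ A *ᵥ w) - c ^ 2 * (w ⬝ᵥ w) ^ 2 := by
  simp only [gain, Matrix.mul_smul, Matrix.smul_mul, trace_smul, trace_mul_vecMulVec,
    vecMulVec_mulVec, op_smul_eq_smul, dotProduct_smul, smul_eq_mul]
  ring

theorem gain_mul_mul_transpose (A : Matrix n n ℝ) (Z : Matrix n m ℝ) (X : Matrix m m ℝ) :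
    gain A (Z * X * Zᵀ) =
      2 * (Zᵀ * A * Z * X).trace - (Zᵀ * Z * X * (Zᵀ * Z * X)).trace := by
  have hlin : (A * (Z * X * Zᵀ)).trace = (Zᵀ * A * Z * X).trace := by
    rw [← Matrix.mul_assoc, trace_mul_comm]
    simp only [Matrix.mul_assoc]
  have hsq : (Z * X * Zᵀ * (Z * X * Zᵀ)).trace = (Zᵀ * Z * X * (Zᵀ * Z * X)).trace := by
    rw [Matrix.mul_assoc (Z * X), trace_mul_comm]
    simp only [Matrix.mul_assoc]
  rw [gain, hlin, hsq]

theorem gain_isometry_conj [DecidableEq m] {Z : Matrix n m ℝ} (hZ : Zᵀ * Z = 1)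
    (A : Matrix n n ℝ) (X : Matrix m m ℝ) : gain A (Z * X * Zᵀ) = gain (Zᵀ * A * Z) X := by
  rw [gain_mul_mul_transpose, hZ, Matrix.one_mul, gain]

theorem submatrix_one_transpose_mul [DecidableEq n] {k l : Type*} (f : k → n) (B : Matrix n l ℝ) :
    ((1 : Matrix n n ℝ).submatrix id f)ᵀ * B = B.submatrix f id := by
  simpa using one_submatrix_mul f (Equiv.refl n) B

theorem mul_submatrix_one_id [DecidableEq n] {k l : Type*} (f : k → n) (B : Matrix l n ℝ) :
    B * (1 : Matrix n n ℝ).submatrix id f = B.submatrix id f :=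
  mul_submatrix_one (Equiv.refl n) f B

theorem gain_submatrix_one [DecidableEq n] {f : m → n}
    (hf : Function.Injective f) (A : Matrix n n ℝ) (X : Matrix m m ℝ) :
    gain A ((1 : Matrix n n ℝ).submatrix id f * X * ((1 : Matrix n n ℝ).submatrix id f)ᵀ) =
      gain (A.submatrix f f) X := by
  classical
  rw [gain_isometry_conj, submatrix_one_transpose_mul, mul_submatrix_one_id, submatrix_submatrix]
  · rfl
  · rw [submatrix_one_transpose_mul, submatrix_submatrix]
    exact submatrix_one f hf

theorem two_mul_mul_posPart_sub_posPart_sq (x : ℝ) : 2 * x * x⁺ - x⁺ ^ 2 = x⁺ ^ 2 := by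
  rcases le_total 0 x with h | h
  · rw [posPart_of_nonneg h]
    ring
  · rw [posPart_of_nonpos h]
    ring

theorem posPart_sq_add_negPart_sq (x : ℝ) : x⁺ ^ 2 + x⁻ ^ 2 = x ^ 2 := by
  rcases le_total 0 x with h | h
  · rw [posPart_of_nonneg h, negPart_of_nonneg h]
    ring
  · rw [posPart_of_nonpos h, negPart_of_nonpos h]
    ring

theorem sum_pos_sq_eq_sum_posPart_sq (l : n → ℝ) :
    ∑ i with 0 < l i, l i ^ 2 = ∑ i, (l i)⁺ ^ 2 := by
  rw [sum_filter]
  refine sum_congr rfl fun i _ => ?_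
  split_ifs with h
  · rw [posPart_of_nonneg h.le]
  · rw [posPart_of_nonpos (not_lt.mp h), zero_pow two_ne_zero]

variable [DecidableEq n]

theorem gain_diagonal_diagonal (l d : n → ℝ) :
    gain (diagonal l) (diagonal d) = ∑ i, (2 * l i * d i - d i ^ 2) := by
  simp [gain, trace_diagonal, mul_sum, sum_sub_distrib, mul_assoc, pow_two]

theorem gain_diagonal_le (l : n → ℝ) {X : Matrix n n ℝ} (hX : X.PosSemidef) :
    gain (diagonal l) X ≤ ∑ i, (l i)⁺ ^ 2 := by
  have hsq : ∑ i, X i i ^ 2 ≤ (X * X).trace := by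
    refine sum_le_sum fun i _ => ?_
    have hsymm (j : n) : X j i = X i j := hX.isHermitian.apply i j
    rw [diag_apply, mul_apply]
    simp only [hsymm, ← pow_two]
    exact single_le_sum (f := fun j => X i j ^ 2) (fun j _ => sq_nonneg _) (mem_univ i)
  have hlin : (diagonal l * X).trace = ∑ i, l i * X i i := by simp [trace]
  calc gain (diagonal l) X ≤ ∑ i, (2 * (l i * X i i) - X i i ^ 2) := by
        rw [gain, hlin, sum_sub_distrib, ← mul_sum]
        linarith
    _ ≤ ∑ i, (l i)⁺ ^ 2 := sum_le_sum fun i _ => by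
        nlinarith [mul_le_mul_of_nonneg_right (le_posPart (l i)) (hX.diag_nonneg (i := i)),
          sq_nonneg ((l i)⁺ - X i i)]

theorem exists_posSemidef_gain_eq {A : Matrix m m ℝ} {U : Matrix m n ℝ} {l : n → ℝ}
    (hU : Uᵀ * U = 1) (hUA : Uᵀ * A * U = diagonal l) :
    ∃ X : Matrix m m ℝ, X.PosSemidef ∧ gain A X = ∑ i, (l i)⁺ ^ 2 := by
  refine ⟨U * diagonal (fun i => (l i)⁺) * Uᵀ,
    (PosSemidef.diagonal fun i => posPart_nonneg _).mul_mul_conjTranspose_same U, ?_⟩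
  simp only [gain_isometry_conj hU, hUA, gain_diagonal_diagonal,
    two_mul_mul_posPart_sub_posPart_sq]

section Hermitian

variable {A : Matrix n n ℝ} (hA : A.IsHermitian)
include hA

theorem exists_orthogonal_diagonalization :
    ∃ U : Matrix n n ℝ, Uᵀ * U = 1 ∧ Uᵀ * A * U = diagonal hA.eigenvalues := by
  refine ⟨hA.eigenvectorUnitary, ?_, ?_⟩
  · simpa [star_eq_conjTranspose] using Unitary.coe_star_mul_self hA.eigenvectorUnitary
  · simpa [Unitary.conjStarAlgAut_apply, star_eq_conjTranspose, Function.comp_def] using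
      hA.conjStarAlgAut_star_eigenvectorUnitary

theorem gain_le_sum_pos_sq {X : Matrix n n ℝ} (hX : X.PosSemidef) :
    gain A X ≤ ∑ i with 0 < hA.eigenvalues i, hA.eigenvalues i ^ 2 := by
  obtain ⟨U, hU, hUA⟩ := exists_orthogonal_diagonalization hA
  have hU' : U * Uᵀ = 1 := mul_eq_one_comm.mp hU
  have hX' : X = U * (Uᵀ * X * U) * Uᵀ := by
    simp only [← Matrix.mul_assoc, hU', Matrix.one_mul]
    rw [Matrix.mul_assoc, hU', Matrix.mul_one]
  rw [hX', gain_isometry_conj hU, hUA, sum_pos_sq_eq_sum_posPart_sq]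
  exact gain_diagonal_le _ (hX.conjTranspose_mul_mul_same U)

theorem exists_gain_eq_sum_pos_sq :
    ∃ X : Matrix n n ℝ, X.PosSemidef ∧
      gain A X = ∑ i with 0 < hA.eigenvalues i, hA.eigenvalues i ^ 2 := by
  obtain ⟨U, hU, hUA⟩ := exists_orthogonal_diagonalization hA
  rw [sum_pos_sq_eq_sum_posPart_sq]
  exact exists_posSemidef_gain_eq hU hUA

theorem trace_mul_self_eq_sum_sq : (A * A).trace = ∑ i, hA.eigenvalues i ^ 2 := by
  obtain ⟨U, hU, hUA⟩ := exists_orthogonal_diagonalization hA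
  have hU' : U * Uᵀ = 1 := mul_eq_one_comm.mp hU
  calc (A * A).trace = (A * (U * Uᵀ) * A * (U * Uᵀ)).trace := by simp only [hU', Matrix.mul_one]
    _ = (Uᵀ * A * U * (Uᵀ * A * U)).trace := by
        rw [← Matrix.mul_assoc, trace_mul_comm]
        simp only [Matrix.mul_assoc]
    _ = ∑ i, hA.eigenvalues i ^ 2 := by simp [hUA, pow_two]

/-- The hypothesis makes the spectrum of `A` symmetric about `0`. -/
theorem trace_mul_self_le_of_similar_neg {Q : Matrix n n ℝ} (hQ : Qᵀ * Q = 1)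
    (hQA : Qᵀ * A * Q = -A) :
    (A * A).trace ≤ 2 * ∑ i with 0 < hA.eigenvalues i, hA.eigenvalues i ^ 2 := by
  obtain ⟨U, hU, hUA⟩ := exists_orthogonal_diagonalization hA
  obtain ⟨N, hN, hgain⟩ : ∃ N : Matrix n n ℝ, N.PosSemidef ∧
      gain A N = ∑ i, (hA.eigenvalues i)⁻ ^ 2 := by
    simp only [← posPart_neg]
    refine exists_posSemidef_gain_eq (U := Q * U) ?_ ?_
    · rw [transpose_mul, Matrix.mul_assoc, ← Matrix.mul_assoc Qᵀ, hQ, Matrix.one_mul, hU]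
    · rw [transpose_mul, show Uᵀ * Qᵀ * A * (Q * U) = Uᵀ * (Qᵀ * A * Q) * U by
        simp only [Matrix.mul_assoc], hQA, Matrix.mul_neg, Matrix.neg_mul, hUA, diagonal_neg]
  have hneg := gain_le_sum_pos_sq hA hN
  have hpos := sum_pos_sq_eq_sum_posPart_sq hA.eigenvalues
  have hsum := sum_congr rfl fun i (_ : i ∈ univ) => posPart_sq_add_negPart_sq (hA.eigenvalues i)
  rw [sum_add_distrib] at hsum
  rw [trace_mul_self_eq_sum_sq hA]
  linarith

end Hermitian

end Gain

section Bipartite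

theorem exists_posSemidef_trace_mul_transpose_le {m n : Type*} [Fintype m] [Fintype n]
    (M : Matrix m n ℝ) :
    ∃ X : Matrix (m ⊕ n) (m ⊕ n) ℝ, X.PosSemidef ∧
      (M * Mᵀ).trace ≤ gain (fromBlocks 0 M Mᵀ 0) X := by
  classical
  have hB : (fromBlocks 0 M Mᵀ 0).IsHermitian := by
    rw [IsHermitian, fromBlocks_conjTranspose]
    simp
  obtain ⟨X, hX, hgain⟩ := exists_gain_eq_sum_pos_sq hB
  refine ⟨X, hX, ?_⟩
  have hle := trace_mul_self_le_of_similar_neg hB (Q := fromBlocks 1 0 0 (-1))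
    (by simp [fromBlocks_transpose, fromBlocks_multiply])
    (by simp [fromBlocks_transpose, fromBlocks_multiply, fromBlocks_neg])
  have htrace : (fromBlocks 0 M Mᵀ 0 * fromBlocks 0 M Mᵀ 0).trace =
      (M * Mᵀ).trace + (Mᵀ * M).trace := by
    simp [fromBlocks_multiply, trace, Fintype.sum_sum_type]
  rw [htrace, trace_mul_comm Mᵀ M, ← hgain] at hle
  linarith

end Bipartite

section PolarCertificate

variable {n ι : Type*} [Fintype ι]

/-- The matrix `½ (ES + Y) S⁻¹ (ES + Y)ᵀ`, with `K` in the role of `S⁻¹`. When the columns of `E`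
are orthonormal, `EᵀY = 0` and `YᵀY = S²`, so that `S` is the polar part of `Y`, it is the positive
part of the rank-`2ι` symmetric matrix `EYᵀ + YEᵀ`. -/
noncomputable def polarCertificate (E Y : Matrix n ι ℝ) (S K : Matrix ι ι ℝ) : Matrix n n ℝ :=
  (E * S + Y) * ((2 : ℝ)⁻¹ • K) * (E * S + Y)ᵀ

variable {E Y : Matrix n ι ℝ} {S K : Matrix ι ι ℝ}

theorem polarCertificate_apply {i j : n} (hi : ∀ k, E i k = 0) (hj : ∀ k, E j k = 0) :
    polarCertificate E Y S K i j = (2 : ℝ)⁻¹ * (Y * K * Yᵀ) i j := by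
  rw [polarCertificate, Matrix.mul_smul, Matrix.smul_mul]
  simp [mul_apply, hi, hj]

theorem posSemidef_polarCertificate [Finite n] (E Y : Matrix n ι ℝ) (S : Matrix ι ι ℝ)
    (hK : K.PosSemidef) : (polarCertificate E Y S K).PosSemidef :=
  (hK.smul (by norm_num)).mul_mul_conjTranspose_same _

variable [Fintype n]

theorem gain_polarCertificate [DecidableEq ι] {A : Matrix n n ℝ} (hA : Aᵀ = A) (hS : Sᵀ = S)
    (hSK : S * K = 1) (hE : Eᵀ * E = 1) (hEY : Eᵀ * Y = 0) (hYY : Yᵀ * Y = S * S)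
    (hEAY : Eᵀ * A * Y = S * S) :
    gain A (polarCertificate E Y S K) =
      (S * S).trace + (Eᵀ * A * E * S).trace + (Yᵀ * A * Y * K).trace := by
  have hYE : Yᵀ * E = 0 := by rw [← transpose_transpose E, ← transpose_mul, hEY, transpose_zero]
  have hYAE : Yᵀ * A * E = S * S := by
    simpa only [transpose_mul, transpose_transpose, hA, hS, Matrix.mul_assoc] using
      congrArg transpose hEAY
  have hFF : (E * S + Y)ᵀ * (E * S + Y) * K = (2 : ℝ) • S := by
    calc (E * S + Y)ᵀ * (E * S + Y) * K
        = (S * (Eᵀ * E) * S + S * (Eᵀ * Y) + Yᵀ * E * S + Yᵀ * Y) * K := by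
          simp only [transpose_add, transpose_mul, hS, Matrix.add_mul, Matrix.mul_add,
            Matrix.mul_assoc]
          abel
      _ = (2 : ℝ) • S := by
          rw [hE, hEY, hYE, hYY, Matrix.mul_one, Matrix.mul_zero, Matrix.zero_mul, add_zero,
            add_zero, ← two_smul ℝ, Matrix.smul_mul, Matrix.mul_assoc, hSK, Matrix.mul_one]
  have hFAF : (E * S + Y)ᵀ * A * (E * S + Y) * K =
      S * (Eᵀ * A * E) + (2 : ℝ) • (S * S) + Yᵀ * A * Y * K := by
    calc (E * S + Y)ᵀ * A * (E * S + Y) * K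
        = S * (Eᵀ * A * E) * (S * K) + S * (Eᵀ * A * Y) * K + Yᵀ * A * E * (S * K) +
            Yᵀ * A * Y * K := by
          simp only [transpose_add, transpose_mul, hS, Matrix.add_mul, Matrix.mul_add,
            Matrix.mul_assoc]
          abel
      _ = S * (Eᵀ * A * E) + (2 : ℝ) • (S * S) + Yᵀ * A * Y * K := by
          rw [hSK, hEAY, hYAE, Matrix.mul_one, Matrix.mul_one, Matrix.mul_assoc S (S * S),
            Matrix.mul_assoc S S K, hSK, Matrix.mul_one, two_smul ℝ, add_assoc (S * _)]
  rw [polarCertificate, gain_mul_mul_transpose]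
  simp only [Matrix.mul_smul, hFF, hFAF, trace_add, trace_smul, Matrix.smul_mul, smul_eq_mul,
    trace_mul_comm S (Eᵀ * A * E)]
  ring

end PolarCertificate

section Graph

theorem sum_adjMatrix_eq_card {V : Type*} {G : SimpleGraph V} [DecidableRel G.Adj] {u : V}
    {s : Finset V} (h : ∀ j ∈ s, G.Adj u j) : ∑ j ∈ s, G.adjMatrix ℝ u j = #s := by
  rw [sum_congr rfl fun j hj => (G.adjMatrix_apply u j).trans (if_pos (h j hj))]
  simp

theorem sum_adjMatrix_eq_card_interedges {V : Type*} (G : SimpleGraph V) [DecidableRel G.Adj]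
    (s t : Finset V) : ∑ i ∈ s, ∑ j ∈ t, G.adjMatrix ℝ i j = #(G.interedges s t) := by
  rw [interedges, Rel.interedges, card_filter, sum_product]
  push_cast
  rfl

variable {V : Type*} [Fintype V] [DecidableEq V] {G : SimpleGraph V} [DecidableRel G.Adj]

theorem gain_le_posSquareEnergy {X : Matrix V V ℝ} (hX : X.PosSemidef) :
    gain (G.adjMatrix ℝ) X ≤ G.posSquareEnergy :=
  gain_le_sum_pos_sq (G.isHermitian_adjMatrix ℝ) hX

theorem posSquareEnergy_add_le {W₁ W₂ : Type*} [Fintype W₁] [DecidableEq W₁] [Fintype W₂]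
    [DecidableEq W₂] {H₁ : SimpleGraph W₁} {H₂ : SimpleGraph W₂} [DecidableRel H₁.Adj]
    [DecidableRel H₂.Adj] (f₁ : H₁ ↪g G) (f₂ : H₂ ↪g G) (hf : ∀ i j, f₁ i ≠ f₂ j) :
    H₁.posSquareEnergy + H₂.posSquareEnergy ≤ G.posSquareEnergy := by
  obtain ⟨X₁, hX₁, hgain₁⟩ := exists_gain_eq_sum_pos_sq (H₁.isHermitian_adjMatrix ℝ)
  obtain ⟨X₂, hX₂, hgain₂⟩ := exists_gain_eq_sum_pos_sq (H₂.isHermitian_adjMatrix ℝ)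
  set Z₁ : Matrix V W₁ ℝ := (1 : Matrix V V ℝ).submatrix id f₁
  set Z₂ : Matrix V W₂ ℝ := (1 : Matrix V V ℝ).submatrix id f₂
  have hZ : Z₁ᵀ * Z₂ = 0 := by
    ext i j
    simp [Z₁, Z₂, mul_apply, one_apply, hf i j]
  have horth : (Z₁ * X₁ * Z₁ᵀ * (Z₂ * X₂ * Z₂ᵀ)).trace = 0 := by
    rw [show Z₁ * X₁ * Z₁ᵀ * (Z₂ * X₂ * Z₂ᵀ) = Z₁ * X₁ * (Z₁ᵀ * Z₂) * X₂ * Z₂ᵀ by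
      simp only [Matrix.mul_assoc], hZ]
    simp
  calc H₁.posSquareEnergy + H₂.posSquareEnergy
      = gain (G.adjMatrix ℝ) (Z₁ * X₁ * Z₁ᵀ + Z₂ * X₂ * Z₂ᵀ) := by
        rw [gain_add, horth, gain_submatrix_one f₁.injective, gain_submatrix_one f₂.injective,
          f₁.submatrix_adjMatrix ℝ, f₂.submatrix_adjMatrix ℝ, hgain₁, hgain₂, mul_zero, sub_zero]
        rfl
    _ ≤ G.posSquareEnergy := gain_le_posSquareEnergy
        ((hX₁.mul_mul_conjTranspose_same Z₁).add (hX₂.mul_mul_conjTranspose_same Z₂))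

theorem card_interedges_le_posSquareEnergy {s t : Finset V} (hst : Disjoint s t)
    (hs : G.IsIndepSet s) (ht : G.IsIndepSet t) : #(G.interedges s t) ≤ G.posSquareEnergy := by
  let f : s ⊕ t → V := Sum.elim (↑) (↑)
  have hf : Function.Injective f :=
    Subtype.val_injective.sumElim Subtype.val_injective fun i j =>
      disjoint_iff_ne.mp hst _ i.2 _ j.2
  have hind {r : Finset V} (hr : G.IsIndepSet r) (i j : r) : ¬G.Adj i j :=
    fun h => hr i.2 j.2 h.ne h
  let M : Matrix s t ℝ := (G.adjMatrix ℝ).submatrix (↑) (↑)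
  have hblocks : (G.adjMatrix ℝ).submatrix f f = fromBlocks 0 M Mᵀ 0 := by
    ext (i | i) (j | j) <;> simp [f, M, hind hs, hind ht]
  have hcast : (#(G.interedges s t) : ℝ) = (M * Mᵀ).trace := by
    rw [← sum_adjMatrix_eq_card_interedges, ← sum_coe_sort s]
    refine sum_congr rfl fun i _ => ?_
    rw [← sum_coe_sort t, diag_apply, mul_apply]
    exact sum_congr rfl fun j _ => by simp [M, adjMatrix_apply]
  obtain ⟨X, hX, hgain⟩ := exists_posSemidef_trace_mul_transpose_le M
  rw [← hcast, ← hblocks, ← gain_submatrix_one hf] at hgain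
  exact hgain.trans (gain_le_posSquareEnergy (hX.mul_mul_conjTranspose_same _))

theorem single_add_single_dotProduct_mulVec {A : Matrix V V ℝ} (hA : A.IsHermitian) (x y : V) :
    (Pi.single x 1 + Pi.single y 1) ⬝ᵥ A *ᵥ (Pi.single x 1 + Pi.single y 1) =
      A x x + 2 * A x y + A y y := by
  have hyx : A y x = A x y := hA.apply x y
  simp only [mulVec_add, add_dotProduct, dotProduct_add, single_one_dotProduct, mulVec_single_one,
    col_apply, hyx]
  ring

theorem gain_add_sq_le_posSquareEnergy {X : Matrix V V ℝ} (hX : X.PosSemidef) {x y : V}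
    (hxy : G.Adj x y) {t : ℝ} (ht : 0 ≤ t) (hXxy : X x x + 2 * X x y + X y y = 2 - 2 * t) :
    gain (G.adjMatrix ℝ) X + t ^ 2 ≤ G.posSquareEnergy := by
  let w : V → ℝ := Pi.single x 1 + Pi.single y 1
  have hAw : w ⬝ᵥ G.adjMatrix ℝ *ᵥ w = 2 := by
    rw [single_add_single_dotProduct_mulVec (G.isHermitian_adjMatrix ℝ)]
    simp [hxy]
  have hww : w ⬝ᵥ w = 2 := by
    simp only [w, add_dotProduct, single_one_dotProduct, Pi.add_apply, Pi.single_eq_same,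
      Pi.single_eq_of_ne hxy.ne, Pi.single_eq_of_ne hxy.ne', add_zero, zero_add,
      one_add_one_eq_two]
  have hXw : w ⬝ᵥ X *ᵥ w = 2 - 2 * t := by
    rw [single_add_single_dotProduct_mulVec hX.isHermitian, hXxy]
  have hX' : (X + (t / 2) • vecMulVec w w).PosSemidef :=
    hX.add ((posSemidef_vecMulVec_self_star w).smul (by positivity))
  refine le_of_eq_of_le ?_ (gain_le_posSquareEnergy hX')
  rw [gain_add, gain_smul_vecMulVec, Matrix.mul_smul, trace_smul, trace_mul_vecMulVec, hAw, hww,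
    hXw, smul_eq_mul]
  ring

end Graph

section Centers

variable {V ι : Type*} [Fintype V] [DecidableEq V] [Fintype ι]

/-- The neighbours of the centre `c k` that are not themselves centres. -/
def outerNeighbors (G : SimpleGraph V) [DecidableRel G.Adj] (c : ι → V) (k : ι) : Finset V :=
  {i | G.Adj (c k) i ∧ ∀ l, i ≠ c l}

/-- The incidence matrix whose `k`-th column is the indicator of `outerNeighbors G c k`. -/
def outerIncidence (G : SimpleGraph V) [DecidableRel G.Adj] (c : ι → V) : Matrix V ι ℝ :=
  of fun i k => if i ∈ outerNeighbors G c k then 1 else 0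

/-- The matrix `½ (ES + Y) S⁻¹ (ES + Y)ᵀ`, where the columns of `E` are the unit vectors at the
centres, `Y` is the incidence matrix of their outer neighbourhoods and `K` stands for `S⁻¹`. -/
noncomputable def centersCertificate (G : SimpleGraph V) [DecidableRel G.Adj] (c : ι → V)
    (S K : Matrix ι ι ℝ) : Matrix V V ℝ :=
  polarCertificate ((1 : Matrix V V ℝ).submatrix id c) (outerIncidence G c) S K

variable {G : SimpleGraph V} [DecidableRel G.Adj] {c : ι → V} {S K : Matrix ι ι ℝ}

theorem posSemidef_centersCertificate (G : SimpleGraph V) [DecidableRel G.Adj] (c : ι → V)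
    (S : Matrix ι ι ℝ) (hK : K.PosSemidef) : (centersCertificate G c S K).PosSemidef :=
  posSemidef_polarCertificate _ _ S hK

theorem centersCertificate_apply {i j : V} (hi : ∀ k, i ≠ c k) (hj : ∀ k, j ≠ c k) :
    centersCertificate G c S K i j =
      (2 : ℝ)⁻¹ * (outerIncidence G c * K * (outerIncidence G c)ᵀ) i j :=
  polarCertificate_apply (fun k => one_apply_ne (hi k)) fun k => one_apply_ne (hj k)

theorem mul_outerIncidence_apply {ι' : Type*} (B : Matrix ι' V ℝ) (l : ι') (k : ι) :
    (B * outerIncidence G c) l k = ∑ i ∈ outerNeighbors G c k, B l i := by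
  simp [mul_apply, outerIncidence]

variable [DecidableEq ι]

theorem gain_centersCertificate (hc : Function.Injective c) (hS : Sᵀ = S) (hSK : S * K = 1)
    (hSS : S * S = of fun k l => (#(outerNeighbors G c k ∩ outerNeighbors G c l) : ℝ)) :
    gain (G.adjMatrix ℝ) (centersCertificate G c S K) =
      ∑ k, (#(outerNeighbors G c k) : ℝ) + ((G.adjMatrix ℝ).submatrix c c * S).trace +
        ((of fun k l => (#(G.interedges (outerNeighbors G c k) (outerNeighbors G c l)) : ℝ)) *
          K).trace := by
  set E := (1 : Matrix V V ℝ).submatrix id c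
  set Y := outerIncidence G c
  have hE : Eᵀ * E = 1 := by
    rw [submatrix_one_transpose_mul, submatrix_submatrix]
    exact submatrix_one c hc
  have hEY : Eᵀ * Y = 0 := by
    ext k l
    rw [mul_outerIncidence_apply]
    refine sum_eq_zero fun i hi => one_apply_ne ?_
    simp only [outerNeighbors, mem_filter_univ] at hi
    exact hi.2 k
  have hYY : Yᵀ * Y = S * S := by
    ext k l
    rw [mul_outerIncidence_apply, hSS]
    simp [Y, outerIncidence, inter_comm, sum_ite_mem]
  have hEAY : Eᵀ * G.adjMatrix ℝ * Y = S * S := by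
    ext k l
    rw [submatrix_one_transpose_mul, mul_outerIncidence_apply, hSS]
    simp only [submatrix_apply, adjMatrix_apply, sum_boole, id, of_apply]
    congr 2
    ext i
    simp only [outerNeighbors, mem_filter, mem_inter, mem_univ, true_and]
    tauto
  have hEAE : Eᵀ * G.adjMatrix ℝ * E = (G.adjMatrix ℝ).submatrix c c := by
    rw [submatrix_one_transpose_mul, mul_submatrix_one_id, submatrix_submatrix]
    rfl
  have hYAY : Yᵀ * G.adjMatrix ℝ * Y =
      of fun k l => (#(G.interedges (outerNeighbors G c k) (outerNeighbors G c l)) : ℝ) := by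
    ext k l
    rw [mul_outerIncidence_apply, of_apply, ← sum_adjMatrix_eq_card_interedges]
    exact (sum_congr rfl fun j _ => by
      simp [Y, outerIncidence, mul_apply, ← sum_filter, filter_inter]).trans sum_comm
  rw [centersCertificate, gain_polarCertificate G.transpose_adjMatrix hS hSK hE hEY hYY hEAY,
    hEAE, hYAY]
  congr 2
  simp [hSS, trace]

end Centers

section DominatingVertex

variable {V : Type*} [Fintype V] {G : SimpleGraph V}

theorem nonempty_iso_star {v : V} (hv : G.IsDominatingVertex v)
    (hN : ∀ x y, G.Adj v x → G.Adj v y → ¬G.Adj x y) :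
    Nonempty (G ≃g completeBipartiteGraph (Fin 1) (Fin (Fintype.card V - 1))) := by
  classical
  have e₁ : {x // x = v} ≃ Fin 1 := Fintype.equivFinOfCardEq (by simp)
  have e₂ : {x // ¬x = v} ≃ Fin (Fintype.card V - 1) :=
    Fintype.equivFinOfCardEq (by simp [Fintype.card_subtype_compl])
  refine ⟨RelIso.symm ⟨(e₁.symm.sumCongr e₂.symm).trans (Equiv.sumCompl (· = v)), ?_⟩⟩
  rintro (a | a) (b | b)
  · simp [(e₁.symm a).2, (e₁.symm b).2]
  · simpa [(e₁.symm a).2] using hv _ (e₂.symm b).2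
  · simpa [(e₁.symm b).2] using (hv _ (e₂.symm a).2).symm
  · simpa using hN _ _ (hv _ (e₂.symm a).2) (hv _ (e₂.symm b).2)

theorem card_eq_degree_add_one [DecidableRel G.Adj] {v : V}
    (hv : G.IsDominatingVertex v) : Fintype.card V = G.degree v + 1 := by
  classical
  have : G.neighborFinset v = univ.erase v := by
    ext w
    simpa using ⟨fun h => h.ne', hv w⟩
  rw [degree, this, card_erase_add_one (mem_univ v), card_univ]

variable [DecidableEq V] [DecidableRel G.Adj]

theorem outerNeighbors_const (G : SimpleGraph V) [DecidableRel G.Adj] (v : V) (k : Unit) :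
    outerNeighbors G (fun _ => v) k = G.neighborFinset v := by
  ext i
  simp only [outerNeighbors, mem_filter_univ, mem_neighborFinset]
  exact ⟨And.left, fun h => ⟨h, fun _ => h.ne'⟩⟩

theorem degree_add_one_le_of_triangle {v x y : V} (hvx : G.Adj v x) (hvy : G.Adj v y)
    (hxy : G.Adj x y) : (G.degree v : ℝ) + 1 ≤ G.posSquareEnergy := by
  set N := G.neighborFinset v with hN
  obtain ⟨σ, hσ, hσσ⟩ : ∃ σ : ℝ, 1 ≤ σ ∧ σ ^ 2 = G.degree v := by
    have hdeg : 1 ≤ G.degree v := (G.degree_pos_iff_exists_adj v).mpr ⟨x, hvx⟩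
    exact ⟨√(G.degree v), Real.one_le_sqrt.mpr (by exact_mod_cast hdeg), Real.sq_sqrt (by simp)⟩
  have hedges : (2 : ℝ) ≤ #(G.interedges N N) := by
    have : 1 < #(G.interedges N N) := one_lt_card.mpr
      ⟨(x, y), G.mem_interedges_iff.mpr (by simp [hN, hvx, hvy, hxy]),
        (y, x), G.mem_interedges_iff.mpr (by simp [hN, hvx, hvy, hxy.symm]), by simp [hxy.ne]⟩
    exact_mod_cast this
  set X := centersCertificate G (fun _ : Unit => v) (σ • 1) (σ⁻¹ • 1) with hX
  have hpsd : X.PosSemidef :=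
    posSemidef_centersCertificate G _ _ (PosSemidef.one.smul (by positivity))
  have hgain : gain (G.adjMatrix ℝ) X = σ ^ 2 + #(G.interedges N N) * σ⁻¹ := by
    rw [hX, gain_centersCertificate (Function.injective_of_subsingleton _)]
    · simp [outerNeighbors_const, trace, hN, hσσ, mul_comm]
    · simp
    · rw [smul_mul_smul_comm, Matrix.mul_one, mul_inv_cancel₀ (by positivity), one_smul]
    · ext k l
      rw [smul_mul_smul_comm, Matrix.mul_one, ← pow_two, hσσ]
      simp [outerNeighbors_const]
  have hentry {i j : V} (hi : G.Adj v i) (hj : G.Adj v j) : X i j = 2⁻¹ * σ⁻¹ := by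
    rw [hX, centersCertificate_apply (fun _ => hi.ne') fun _ => hj.ne']
    simp [outerIncidence, outerNeighbors_const, mul_apply, hi, hj]
  have hle := gain_add_sq_le_posSquareEnergy hpsd hxy (t := 1 - σ⁻¹)
    (by simpa using inv_le_one_of_one_le₀ hσ)
    (by rw [hentry hvx hvx, hentry hvx hvy, hentry hvy hvy]; ring)
  rw [hgain] at hle
  nlinarith [mul_le_mul_of_nonneg_right hedges (by positivity : 0 ≤ σ⁻¹), sq_nonneg σ⁻¹]

theorem degree_le_posSquareEnergy (v : V) : (G.degree v : ℝ) ≤ G.posSquareEnergy := by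
  by_cases hN : G.IsIndepSet (G.neighborFinset v)
  · refine le_of_eq_of_le ?_ (card_interedges_le_posSquareEnergy (s := {v})
      (t := G.neighborFinset v) (by simp) (by simp) hN)
    rw [← sum_adjMatrix_eq_card_interedges, sum_singleton, ← card_neighborFinset_eq_degree,
      sum_adjMatrix_eq_card fun j hj => (G.mem_neighborFinset v j).mp hj]
  · simp only [IsIndepSet, Set.Pairwise, mem_coe, mem_neighborFinset] at hN
    push Not at hN
    obtain ⟨x, hx, y, hy, -, hxy⟩ := hN
    linarith [degree_add_one_le_of_triangle hx hy hxy]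

end DominatingVertex

section Split

/-- The set `{u, v}` is dominating, for `u` and `v` not necessarily distinct. -/
def IsDominatingPair {V : Type*} (G : SimpleGraph V) (u v : V) : Prop :=
  ∀ w, w ≠ u → w ≠ v → G.Adj u w ∨ G.Adj v w

theorem IsDominatingPair.symm {V : Type*} {G : SimpleGraph V} {u v : V}
    (hdom : IsDominatingPair G u v) : IsDominatingPair G v u :=
  fun w hwv hwu => (hdom w hwu hwv).symm

theorem exists_isDominatingPair_of_dominationNumber_le_two {V : Type*} [Fintype V] [Nonempty V]
    {G : SimpleGraph V} (h : G.dominationNumber ≤ 2) : ∃ u v, IsDominatingPair G u v := by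
  classical
  obtain ⟨D, hD, hcard⟩ := Nat.sInf_mem (s := {k | ∃ D : Finset V, G.IsDominatingSet D ∧ #D = k})
    ⟨_, univ, fun w hw => absurd (mem_univ w) hw, rfl⟩
  replace hcard : #D ≤ 2 := hcard.trans_le h
  obtain ⟨u, hu⟩ : ∃ u, #(D.erase u) ≤ 1 := by
    rcases D.eq_empty_or_nonempty with rfl | ⟨u, hu⟩
    · simp
    · exact ⟨u, by rw [card_erase_of_mem hu]; lia⟩
  obtain ⟨v, hv⟩ := card_le_one_iff_subset_singleton.mp hu
  have hsub : D ⊆ {u, v} := subset_insert_iff.mpr hv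
  refine ⟨u, v, fun w hwu hwv => ?_⟩
  obtain ⟨x, hx, hxw⟩ := hD w fun hw => by simpa [hwu, hwv] using hsub hw
  rcases mem_insert.mp (hsub hx) with rfl | hx
  · exact Or.inl hxw
  · exact Or.inr (mem_singleton.mp hx ▸ hxw)

variable {V : Type*} [Fintype V] [DecidableEq V] {G : SimpleGraph V} [DecidableRel G.Adj]

theorem card_sub_one_le_of_isDominatingVertex {v : V} (hv : G.IsDominatingVertex v) :
    (Fintype.card V : ℝ) - 1 ≤ G.posSquareEnergy := by
  simpa [card_eq_degree_add_one hv] using degree_le_posSquareEnergy (G := G) v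

theorem card_le_of_isDominatingVertex_of_adj {v x y : V} (hv : G.IsDominatingVertex v)
    (hx : x ≠ v) (hy : y ≠ v) (hxy : G.Adj x y) : (Fintype.card V : ℝ) ≤ G.posSquareEnergy := by
  simpa [card_eq_degree_add_one hv] using degree_add_one_le_of_triangle (hv x hx) (hv y hy) hxy

/-- The neighbours of `u` other than `v`. -/
def neighborsExcept (G : SimpleGraph V) [DecidableRel G.Adj] (u v : V) : Finset V :=
  (G.neighborFinset u).erase v

theorem mem_neighborsExcept {u v w : V} : w ∈ neighborsExcept G u v ↔ w ≠ v ∧ G.Adj u w := by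
  simp [neighborsExcept]

theorem card_sub_one_le_of_not_isIndepSet {u v : V} (huv : u ≠ v) (hdom : IsDominatingPair G u v)
    (hU : ¬G.IsIndepSet (neighborsExcept G u v)) :
    (Fintype.card V : ℝ) - 1 ≤ G.posSquareEnergy := by
  classical
  simp only [IsIndepSet, Set.Pairwise, mem_coe, mem_neighborsExcept] at hU
  push Not at hU
  obtain ⟨x, ⟨hxv, hux⟩, y, ⟨hyv, huy⟩, -, hxy⟩ := hU
  let s : Set V := {w | w = u ∨ w ≠ v ∧ G.Adj u w}
  have hu : (G.induce s).IsDominatingVertex ⟨u, Or.inl rfl⟩ := fun w hw =>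
    (w.2.resolve_left fun h => hw (Subtype.ext h)).2
  have hv : (G.induce sᶜ).IsDominatingVertex ⟨v, by simp [s, huv.symm]⟩ := fun w hw => by
    have hwv : (w : V) ≠ v := fun h => hw (Subtype.ext h)
    have hws : ¬((w : V) = u ∨ (w : V) ≠ v ∧ G.Adj u w) := w.2
    push Not at hws
    exact (hdom w hws.1 hwv).resolve_left (hws.2 hwv)
  have h₁ := card_le_of_isDominatingVertex_of_adj (x := ⟨x, Or.inr ⟨hxv, hux⟩⟩)
    (y := ⟨y, Or.inr ⟨hyv, huy⟩⟩) hu (by simpa using hux.ne') (by simpa using huy.ne')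
    (induce_adj.mpr hxy)
  have h₂ := card_sub_one_le_of_isDominatingVertex hv
  have hadd := posSquareEnergy_add_le (Embedding.induce s) (Embedding.induce (G := G) sᶜ)
    fun i j h => j.2 (show (j : V) ∈ s from (show (i : V) = j from h) ▸ i.2)
  have hcard : (Fintype.card V : ℝ) = Fintype.card s + Fintype.card (sᶜ : Set V) := by
    exact_mod_cast (Fintype.card_congr (Equiv.Set.sumCompl s)).symm.trans Fintype.card_sum
  linarith

end Split

section Pair

variable {V : Type*} [Fintype V] [DecidableEq V] {G : SimpleGraph V} [DecidableRel G.Adj] {u v : V}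

/-- The neighbours of `u` other than `v` that are not neighbours of `v`. -/
def privateNeighbors (G : SimpleGraph V) [DecidableRel G.Adj] (u v : V) : Finset V :=
  neighborsExcept G u v \ neighborsExcept G v u

/-- The edges from neighbours of `u` to neighbours of `v` in `G - {u, v}`, as ordered pairs. -/
def crossEdges (G : SimpleGraph V) [DecidableRel G.Adj] (u v : V) : Finset (V × V) :=
  G.interedges (neighborsExcept G u v) (neighborsExcept G v u)

theorem adj_of_mem_neighborsExcept {j : V} (hj : j ∈ neighborsExcept G u v) : G.Adj u j :=
  (mem_neighborsExcept.mp hj).2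

theorem notMem_neighborsExcept_left : u ∉ neighborsExcept G u v := by
  simp [mem_neighborsExcept]

theorem notMem_neighborsExcept_right : v ∉ neighborsExcept G u v := by
  simp [mem_neighborsExcept]

theorem mem_privateNeighbors {w : V} :
    w ∈ privateNeighbors G u v ↔ w ∈ neighborsExcept G u v ∧ w ∉ neighborsExcept G v u :=
  mem_sdiff

theorem adj_of_mem_privateNeighbors {w : V} (hw : w ∈ privateNeighbors G u v) : G.Adj u w :=
  adj_of_mem_neighborsExcept (mem_privateNeighbors.mp hw).1

theorem card_neighborsExcept (G : SimpleGraph V) [DecidableRel G.Adj] (u v : V) :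
    #(neighborsExcept G u v) =
      #(privateNeighbors G u v) + #(neighborsExcept G u v ∩ neighborsExcept G v u) :=
  (card_sdiff_add_card_inter _ _).symm

theorem card_eq_of_isDominatingPair (huv : u ≠ v) (hdom : IsDominatingPair G u v) :
    Fintype.card V = #(privateNeighbors G u v) + #(privateNeighbors G v u) +
      #(neighborsExcept G u v ∩ neighborsExcept G v u) + 2 := by
  have huniv : univ = insert u (insert v (neighborsExcept G u v ∪ neighborsExcept G v u)) := by
    ext w
    have := hdom w
    simp only [mem_univ, mem_insert, mem_union, mem_neighborsExcept, true_iff]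
    tauto
  rw [← card_univ, huniv, card_insert_of_notMem, card_insert_of_notMem]
  · have hinter := card_union_add_card_inter (neighborsExcept G u v) (neighborsExcept G v u)
    have hU := card_neighborsExcept G u v
    have hW := card_neighborsExcept G v u
    rw [inter_comm] at hW
    omega
  · simp [mem_neighborsExcept]
  · simp [mem_neighborsExcept, huv]

theorem mem_crossEdges {i j : V} : (i, j) ∈ crossEdges G u v ↔
    i ∈ neighborsExcept G u v ∧ j ∈ neighborsExcept G v u ∧ G.Adj i j :=
  G.mk_mem_interedges_iff

theorem card_crossEdges_comm (G : SimpleGraph V) [DecidableRel G.Adj] (u v : V) :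
    #(crossEdges G v u) = #(crossEdges G u v) :=
  haveI := G.symm
  Rel.card_interedges_comm _ _

theorem crossEdges_eq_interedges_privateNeighbors (hU : G.IsIndepSet (neighborsExcept G u v))
    (hW : G.IsIndepSet (neighborsExcept G v u)) :
    crossEdges G u v = G.interedges (privateNeighbors G u v) (privateNeighbors G v u) := by
  ext ⟨i, j⟩
  simp only [mem_crossEdges, mk_mem_interedges_iff, mem_privateNeighbors]
  refine ⟨fun ⟨hi, hj, hij⟩ => ?_, fun h => ⟨h.1.1, h.2.1.1, h.2.2⟩⟩
  exact ⟨⟨hi, fun hi' => hW hi' hj hij.ne hij⟩, ⟨hj, fun hj' => hU hi hj' hij.ne hij⟩, hij⟩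

theorem isIndepSet_insert_privateNeighbors (hU : G.IsIndepSet (neighborsExcept G u v)) :
    G.IsIndepSet (insert v (privateNeighbors G u v) : Finset V) := by
  rw [coe_insert]
  refine Set.Pairwise.insert (hU.mono (coe_subset.mpr sdiff_subset)) fun j hj _ => ?_
  rw [G.adj_comm j v, and_self]
  obtain ⟨hju, hjv⟩ := mem_privateNeighbors.mp (mem_coe.mp hj)
  exact fun hvj => hjv (mem_neighborsExcept.mpr ⟨(adj_of_mem_neighborsExcept hju).ne', hvj⟩)

theorem adjMatrix_add_card_le_posSquareEnergy (huv : u ≠ v)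
    (hU : G.IsIndepSet (neighborsExcept G u v)) (hW : G.IsIndepSet (neighborsExcept G v u)) :
    G.adjMatrix ℝ u v + #(privateNeighbors G u v) + #(privateNeighbors G v u) +
      #(crossEdges G u v) ≤ G.posSquareEnergy := by
  refine le_of_eq_of_le ?_ (card_interedges_le_posSquareEnergy ?_
    (isIndepSet_insert_privateNeighbors hU) (isIndepSet_insert_privateNeighbors hW))
  · have hsum : ∑ i ∈ privateNeighbors G u v, G.adjMatrix ℝ i u = #(privateNeighbors G u v) := by
      rw [← sum_adjMatrix_eq_card fun i hi => adj_of_mem_privateNeighbors hi]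
      exact sum_congr rfl fun i _ => (G.isSymm_adjMatrix (α := ℝ)).apply u i
    have hnotMem {a b : V} : b ∉ privateNeighbors G a b := fun h =>
      notMem_neighborsExcept_right (mem_privateNeighbors.mp h).1
    rw [crossEdges_eq_interedges_privateNeighbors hU hW, ← sum_adjMatrix_eq_card_interedges,
      ← sum_adjMatrix_eq_card_interedges, sum_insert hnotMem]
    simp only [sum_insert hnotMem, sum_add_distrib]
    rw [hsum, sum_adjMatrix_eq_card fun j hj => adj_of_mem_privateNeighbors hj,
      (G.isSymm_adjMatrix (α := ℝ)).apply u v]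
    ring
  · rw [disjoint_iff_ne]
    simp only [mem_insert, mem_privateNeighbors]
    rintro a (rfl | ha) b (rfl | hb)
    · exact huv.symm
    · exact fun h => notMem_neighborsExcept_left (h ▸ hb.1)
    · exact fun h => notMem_neighborsExcept_left (h ▸ ha.1)
    · exact fun h => ha.2 (h ▸ hb.1)

theorem card_neighborsExcept_add_le_posSquareEnergy (huv : u ≠ v) (hadj : ¬G.Adj u v)
    (hU : G.IsIndepSet (neighborsExcept G u v)) (hW : G.IsIndepSet (neighborsExcept G v u))
    (hUW : crossEdges G u v = ∅) :
    (#(neighborsExcept G u v) : ℝ) + #(neighborsExcept G v u) ≤ G.posSquareEnergy := by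
  have hcenters : G.IsIndepSet ({u, v} : Finset V) := by
    rw [coe_pair]
    exact Set.pairwise_pair.mpr fun _ => ⟨hadj, fun h => hadj h.symm⟩
  have hno {i j : V} (hi : i ∈ neighborsExcept G u v) (hj : j ∈ neighborsExcept G v u) :
      ¬G.Adj i j := fun h =>
    notMem_empty (i, j) (hUW ▸ mem_crossEdges.mpr ⟨hi, hj, h⟩)
  have hunion : G.IsIndepSet (neighborsExcept G u v ∪ neighborsExcept G v u : Finset V) := by
    rw [coe_union]
    exact Set.pairwise_union.mpr ⟨hU, hW, fun i hi j hj _ =>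
      ⟨hno hi hj, fun h => hno hi hj h.symm⟩⟩
  have hcard {a : V} {s : Finset V} (ha : ∀ j ∈ s, G.Adj a j)
      (hs : s ⊆ neighborsExcept G u v ∪ neighborsExcept G v u) :
      (#s : ℝ) ≤ ∑ j ∈ neighborsExcept G u v ∪ neighborsExcept G v u, G.adjMatrix ℝ a j := by
    rw [← sum_adjMatrix_eq_card ha]
    refine sum_le_sum_of_subset_of_nonneg hs fun j _ _ => ?_
    rw [adjMatrix_apply]
    positivity
  refine le_trans ?_ (card_interedges_le_posSquareEnergy (s := {u, v}) ?_ hcenters hunion)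
  · rw [← sum_adjMatrix_eq_card_interedges, sum_pair huv]
    exact add_le_add (hcard (fun _ => adj_of_mem_neighborsExcept) subset_union_left)
      (hcard (fun _ => adj_of_mem_neighborsExcept) subset_union_right)
  · simp [mem_neighborsExcept]

theorem inter_nonempty_or_crossEdges_nonempty (hG : G.Connected) (huv : u ≠ v)
    (hadj : ¬G.Adj u v) (hdom : IsDominatingPair G u v) :
    (neighborsExcept G u v ∩ neighborsExcept G v u).Nonempty ∨ (crossEdges G u v).Nonempty := by
  obtain ⟨w⟩ := hG.preconnected u v
  obtain ⟨d, -, hfst, hsnd⟩ := w.exists_boundary_dart {x | x = u ∨ G.Adj u x} (Or.inl rfl)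
    (not_or.mpr ⟨huv.symm, hadj⟩)
  have hd := d.adj
  obtain ⟨hsndu, hnadj⟩ := not_or.mp hsnd
  have hufst : G.Adj u d.fst := hfst.resolve_left fun h => hnadj (h ▸ hd)
  have hU : d.fst ∈ neighborsExcept G u v :=
    mem_neighborsExcept.mpr ⟨fun h => hadj (h ▸ hufst), hufst⟩
  by_cases hsndv : d.snd = v
  · exact Or.inl ⟨d.fst, mem_inter.mpr ⟨hU,
      mem_neighborsExcept.mpr ⟨hufst.ne', hsndv ▸ hd.symm⟩⟩⟩
  · exact Or.inr ⟨(d.fst, d.snd), mem_crossEdges.mpr ⟨hU,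
      mem_neighborsExcept.mpr ⟨hsndu, (hdom _ hsndu hsndv).resolve_left hnadj⟩, hd⟩⟩

end Pair

section TwoCenters

/-- The square root of `D = !![p + r, r; r, q + r]`. By Cayley–Hamilton it is `(D + δ) / τ`, where
`δ = √(det D)` and `τ = √(tr D + 2δ)`. -/
noncomputable def gramSqrt (p q r δ τ : ℝ) : Matrix (Fin 2) (Fin 2) ℝ :=
  τ⁻¹ • !![p + r + δ, r; r, q + r + δ]

/-- The inverse of `gramSqrt p q r δ τ`, whose determinant is `δ`. -/
noncomputable def gramInvSqrt (p q r δ τ : ℝ) : Matrix (Fin 2) (Fin 2) ℝ :=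
  (τ * δ)⁻¹ • !![q + r + δ, -r; -r, p + r + δ]

section Scalar

variable {p q r δ τ : ℝ}

theorem gramSqrt_mul_self (hτ : 0 < τ) (hδδ : δ ^ 2 = p * q + r * (p + q))
    (hττ : τ ^ 2 = p + q + 2 * r + 2 * δ) :
    gramSqrt p q r δ τ * gramSqrt p q r δ τ = !![p + r, r; r, q + r] := by
  ext i j
  fin_cases i <;> fin_cases j <;> simp [gramSqrt, mul_apply, Fin.sum_univ_two] <;> field_simp <;>
    grind

theorem gramSqrt_mul_gramInvSqrt (hδ : 0 < δ) (hτ : 0 < τ) (hδδ : δ ^ 2 = p * q + r * (p + q))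
    (hττ : τ ^ 2 = p + q + 2 * r + 2 * δ) :
    gramSqrt p q r δ τ * gramInvSqrt p q r δ τ = 1 := by
  ext i j
  fin_cases i <;> fin_cases j <;>
    simp [gramSqrt, gramInvSqrt, mul_apply, Fin.sum_univ_two] <;> field_simp <;> grind

theorem posSemidef_gramInvSqrt (hp : 0 ≤ p) (hq : 0 ≤ q) (hr : 0 ≤ r) (hδ : 0 < δ) (hτ : 0 < τ) :
    (gramInvSqrt p q r δ τ).PosSemidef := by
  have heq : !![q + r + δ, -r; -r, p + r + δ] =
      r • vecMulVec ![1, -1] (star ![1, -1]) + diagonal ![q + δ, p + δ] := by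
    ext i j
    fin_cases i <;> fin_cases j <;> simp <;> ring
  rw [gramInvSqrt, heq]
  refine (((posSemidef_vecMulVec_self_star _).smul hr).add (.diagonal fun i => ?_)).smul
    (by positivity)
  fin_cases i
  · exact (add_pos_of_nonneg_of_pos hq hδ).le
  · exact (add_pos_of_nonneg_of_pos hp hδ).le

theorem exists_sq_eq_det_and_sq_eq_trace (hp : 0 < p) (hq : 0 < q) (hr : 0 ≤ r) :
    ∃ δ τ : ℝ, 0 < δ ∧ 0 < τ ∧ δ ^ 2 = p * q + r * (p + q) ∧ τ ^ 2 = p + q + 2 * r + 2 * δ := by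
  obtain ⟨δ, hδ, hδδ⟩ : ∃ δ : ℝ, 0 < δ ∧ δ ^ 2 = p * q + r * (p + q) :=
    ⟨√(p * q + r * (p + q)), by positivity, Real.sq_sqrt (by positivity)⟩
  exact ⟨δ, √(p + q + 2 * r + 2 * δ), hδ, by positivity, hδδ, Real.sq_sqrt (by positivity)⟩

theorem trace_antidiagonal_mul_gramSqrt (a : ℝ) :
    (!![0, a; a, 0] * gramSqrt p q r δ τ).trace = 2 * r / τ * a := by
  simp only [gramSqrt, Matrix.mul_smul, trace_smul, mul_fin_two, trace_fin_two_of, smul_eq_mul]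
  ring

theorem trace_antidiagonal_mul_gramInvSqrt (a : ℝ) :
    (!![0, a; a, 0] * gramInvSqrt p q r δ τ).trace = -(2 * r / (τ * δ) * a) := by
  simp only [gramInvSqrt, Matrix.mul_smul, trace_smul, mul_fin_two, trace_fin_two_of, smul_eq_mul]
  ring

theorem four_mul_le_mul_of_sq_eq {e : ℝ} (hp : 0 ≤ p) (hq : 0 ≤ q) (he : 1 ≤ e) (her : e ≤ r)
    (hepq : e ≤ p * q) (hδ : 0 < δ) (hτ : 0 < τ) (hδδ : δ ^ 2 = p * q + r * (p + q))
    (hττ : τ ^ 2 = p + q + 2 * r + 2 * δ) : 4 * e ≤ τ * δ := by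
  obtain ⟨a, ha, rfl⟩ : ∃ a : ℝ, 0 ≤ a ∧ a ^ 2 = e := ⟨√e, by simp, Real.sq_sqrt (by linarith)⟩
  have ha' : 1 ≤ a := (one_le_sq_iff₀ ha).mp he
  have har : a ≤ r := (le_self_pow₀ ha' two_ne_zero).trans her
  have hpq : 2 * a ≤ p + q := le_of_sq_le_sq (by nlinarith [sq_nonneg (p - q)]) (by positivity)
  have hdet : a ^ 2 + 2 * a ^ 3 ≤ δ ^ 2 := by
    nlinarith [mul_le_mul her hpq (by positivity) (ha.trans har)]
  -- `δ² ≥ a² + 2a³ ≥ 3a²`, and `17 / 10 < √3`.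
  have hδa : 17 / 10 * a ≤ δ :=
    le_of_sq_le_sq (by nlinarith [mul_nonneg (sq_nonneg a) (sub_nonneg.mpr ha')]) hδ.le
  have htrace : 2 * a ^ 2 + 27 / 5 * a ≤ τ ^ 2 := by linarith
  refine le_of_sq_le_sq ?_ (by positivity)
  calc (4 * a ^ 2) ^ 2 ≤ (2 * a ^ 2 + 27 / 5 * a) * (a ^ 2 + 2 * a ^ 3) := by
        have : 0 ≤ a ^ 3 * (4 * a ^ 2 - 16 / 5 * a + 27 / 5) :=
          mul_nonneg (by positivity) (by nlinarith [sq_nonneg (2 * a - 1)])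
        linarith
    _ ≤ τ ^ 2 * δ ^ 2 := by gcongr
    _ = (τ * δ) ^ 2 := by ring

theorem two_div_mul_le_sq_of_sq_eq (hp : 1 ≤ p) (hq : 1 ≤ q) (hδ : 0 < δ) (hτ : 0 < τ)
    (hδδ : δ ^ 2 = p * q + (p + q)) (hττ : τ ^ 2 = p + q + 2 + 2 * δ) :
    0 ≤ 1 - (p + q + 2 * δ) / (4 * (τ * δ)) ∧
      2 / (τ * δ) ≤ (1 - (p + q + 2 * δ) / (4 * (τ * δ))) ^ 2 := by
  have hpq : 0 ≤ (p - 1) * (q - 1) := mul_nonneg (by linarith) (by linarith)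
  -- The constants approximate the values at `p = q = 1`, where `δ = √3` and `τ = 1 + √3`.
  have hδ' : 17 / 10 ≤ δ := by nlinarith
  have hτδ : 21 / 5 ≤ τ * δ := by
    refine le_of_sq_le_sq ?_ (by positivity)
    nlinarith [mul_pow τ δ 2]
  have hnum : p + q + 2 * δ ≤ 6 / 5 * (τ * δ) := by
    set y := p + q + 2 * δ with hy
    have hyδ : y ≤ (δ ^ 2 + 1) / 2 + 2 * δ := by linarith
    have hy' : 27 / 5 ≤ y := by linarith
    have hsq : y - 29 / 20 ≤ 36 / 25 * δ ^ 2 := by nlinarith [hyδ, hδ']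
    refine le_of_sq_le_sq ?_ (by positivity)
    calc y ^ 2 ≤ (y + 2) * (y - 29 / 20) := by linarith [hy']
      _ ≤ (y + 2) * (36 / 25 * δ ^ 2) := by gcongr
      _ = (6 / 5 * (τ * δ)) ^ 2 := by
        rw [mul_pow, mul_pow, hττ, hy]
        ring
  have hquot : (p + q + 2 * δ) / (4 * (τ * δ)) ≤ 3 / 10 := by
    rw [div_le_iff₀ (by positivity)]
    linarith
  refine ⟨by linarith, ?_⟩
  calc 2 / (τ * δ) ≤ 2 / (21 / 5) := by gcongr
    _ ≤ (1 - 3 / 10) ^ 2 := by norm_num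
    _ ≤ (1 - (p + q + 2 * δ) / (4 * (τ * δ))) ^ 2 := by gcongr

end Scalar

theorem adjMatrix_submatrix_pair {V : Type*} (G : SimpleGraph V) [DecidableRel G.Adj]
    (u v : V) :
    (G.adjMatrix ℝ).submatrix ![u, v] ![u, v] =
      !![0, G.adjMatrix ℝ u v; G.adjMatrix ℝ u v, 0] := by
  ext k l
  fin_cases k <;> fin_cases l <;> simp [G.adj_comm v u]

variable {V : Type*} [Fintype V] [DecidableEq V] {G : SimpleGraph V} [DecidableRel G.Adj] {u v : V}

theorem outerNeighbors_pair (G : SimpleGraph V) [DecidableRel G.Adj] (u v : V) :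
    outerNeighbors G ![u, v] = ![neighborsExcept G u v, neighborsExcept G v u] := by
  ext k i
  fin_cases k
  · simpa [outerNeighbors, mem_neighborsExcept] using
      ⟨fun h => ⟨h.2.2, h.1⟩, fun h => ⟨h.2, h.2.ne', h.1⟩⟩
  · simpa [outerNeighbors, mem_neighborsExcept] using
      ⟨fun h => ⟨h.2.1, h.1⟩, fun h => ⟨h.2, h.1, h.2.ne'⟩⟩

theorem card_interedges_pair (hU : G.IsIndepSet (neighborsExcept G u v))
    (hW : G.IsIndepSet (neighborsExcept G v u)) :
    (of fun k l => (#(G.interedges (outerNeighbors G ![u, v] k)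
      (outerNeighbors G ![u, v] l)) : ℝ)) =
      !![0, (#(crossEdges G u v) : ℝ); #(crossEdges G u v), 0] := by
  have hempty {s : Finset V} (hs : G.IsIndepSet s) : G.interedges s s = ∅ :=
    eq_empty_of_forall_notMem fun ⟨i, j⟩ h =>
      have ⟨hi, hj, hij⟩ := G.mk_mem_interedges_iff.mp h
      hs hi hj hij.ne hij
  have hcross (a b : V) :
      G.interedges (neighborsExcept G a b) (neighborsExcept G b a) = crossEdges G a b := rfl
  ext k l
  fin_cases k <;> fin_cases l <;>
    simp [outerNeighbors_pair, hempty hU, hempty hW, hcross, card_crossEdges_comm G u v]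

variable {p q r : ℕ} {δ τ : ℝ}

theorem gain_centersCertificate_pair (huv : u ≠ v) (hU : G.IsIndepSet (neighborsExcept G u v))
    (hW : G.IsIndepSet (neighborsExcept G v u)) (hp : #(privateNeighbors G u v) = p)
    (hq : #(privateNeighbors G v u) = q)
    (hr : #(neighborsExcept G u v ∩ neighborsExcept G v u) = r) (hδ : 0 < δ) (hτ : 0 < τ)
    (hδδ : δ ^ 2 = p * q + r * (p + q)) (hττ : τ ^ 2 = p + q + 2 * r + 2 * δ) :
    gain (G.adjMatrix ℝ)
        (centersCertificate G ![u, v] (gramSqrt p q r δ τ) (gramInvSqrt p q r δ τ)) =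
      p + q + 2 * r + 2 * r / τ * G.adjMatrix ℝ u v - 2 * r / (τ * δ) * #(crossEdges G u v) := by
  have hpr : #(neighborsExcept G u v) = p + r := by rw [card_neighborsExcept, hp, hr]
  have hqr : #(neighborsExcept G v u) = q + r := by rw [card_neighborsExcept, hq, inter_comm, hr]
  have hinj : Function.Injective ![u, v] := by
    intro k l
    fin_cases k <;> fin_cases l <;> simp [huv, huv.symm]
  have hsymm : (gramSqrt p q r δ τ)ᵀ = gramSqrt p q r δ τ := by
    ext k l
    fin_cases k <;> fin_cases l <;> simp [gramSqrt]
  have hgram : gramSqrt p q r δ τ * gramSqrt p q r δ τ = of fun k l =>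
      (#(outerNeighbors G ![u, v] k ∩ outerNeighbors G ![u, v] l) : ℝ) := by
    rw [gramSqrt_mul_self hτ hδδ hττ]
    ext k l
    fin_cases k <;> fin_cases l <;> simp [outerNeighbors_pair, hpr, hqr, hr, inter_comm]
  rw [gain_centersCertificate hinj hsymm (gramSqrt_mul_gramInvSqrt hδ hτ hδδ hττ) hgram,
    adjMatrix_submatrix_pair, trace_antidiagonal_mul_gramSqrt, card_interedges_pair hU hW,
    trace_antidiagonal_mul_gramInvSqrt, outerNeighbors_pair]
  simp only [Fin.sum_univ_two, cons_val_zero, cons_val_one, hpr, hqr]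
  push_cast
  ring

theorem centersCertificate_pair_apply_add {p q r : ℝ} {x y : V} (hx : x ∈ privateNeighbors G u v)
    (hy : y ∈ privateNeighbors G v u) (hδ : 0 < δ) (hτ : 0 < τ) :
    let X := centersCertificate G ![u, v] (gramSqrt p q r δ τ) (gramInvSqrt p q r δ τ)
    X x x + 2 * X x y + X y y = (p + q + 2 * δ) / (2 * (τ * δ)) := by
  rw [mem_privateNeighbors] at hx hy
  have hxc (k : Fin 2) : x ≠ ![u, v] k := by
    fin_cases k
    · exact (adj_of_mem_neighborsExcept hx.1).ne'
    · exact fun h => notMem_neighborsExcept_right (h ▸ hx.1)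
  have hyc (k : Fin 2) : y ≠ ![u, v] k := by
    fin_cases k
    · exact fun h => notMem_neighborsExcept_right (h ▸ hy.1)
    · exact (adj_of_mem_neighborsExcept hy.1).ne'
  have hxY : outerIncidence G ![u, v] x = ![1, 0] := by
    ext k
    fin_cases k <;> simp [outerIncidence, outerNeighbors_pair, hx]
  have hyY : outerIncidence G ![u, v] y = ![0, 1] := by
    ext k
    fin_cases k <;> simp [outerIncidence, outerNeighbors_pair, hy]
  simp only [centersCertificate_apply hxc hxc, centersCertificate_apply hxc hyc,
    centersCertificate_apply hyc hyc, mul_apply, transpose_apply, Fin.sum_univ_two, hxY, hyY,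
    gramInvSqrt, Matrix.smul_apply, of_apply, cons_val_zero, cons_val_one, smul_eq_mul]
  field_simp
  ring

theorem exists_posSemidef_le_gain (huv : u ≠ v) (hU : G.IsIndepSet (neighborsExcept G u v))
    (hW : G.IsIndepSet (neighborsExcept G v u)) (hp : #(privateNeighbors G u v) = p)
    (hq : #(privateNeighbors G v u) = q)
    (hr : #(neighborsExcept G u v ∩ neighborsExcept G v u) = r) (hδ : 0 < δ) (hτ : 0 < τ)
    (hδδ : δ ^ 2 = p * q + r * (p + q)) (hττ : τ ^ 2 = p + q + 2 * r + 2 * δ) :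
    ∃ X : Matrix V V ℝ, X.PosSemidef ∧
      p + q + 2 * r - 2 * r / (τ * δ) * #(crossEdges G u v) ≤ gain (G.adjMatrix ℝ) X ∧
      ∀ x ∈ privateNeighbors G u v, ∀ y ∈ privateNeighbors G v u,
        X x x + 2 * X x y + X y y = (p + q + 2 * δ) / (2 * (τ * δ)) := by
  refine ⟨centersCertificate G ![u, v] (gramSqrt p q r δ τ) (gramInvSqrt p q r δ τ),
    posSemidef_centersCertificate G _ _ (posSemidef_gramInvSqrt (Nat.cast_nonneg p)
      (Nat.cast_nonneg q) (Nat.cast_nonneg r) hδ hτ), ?_, fun x hx y hy =>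
      centersCertificate_pair_apply_add hx hy hδ hτ⟩
  have hadj : 0 ≤ 2 * r / τ * G.adjMatrix ℝ u v := by
    rw [adjMatrix_apply]
    positivity
  rw [gain_centersCertificate_pair huv hU hW hp hq hr hδ hτ hδδ hττ]
  linarith

end TwoCenters

section DominatingPair

variable {V : Type*} [Fintype V] [DecidableEq V] {G : SimpleGraph V} [DecidableRel G.Adj] {u v : V}
  {p q r : ℕ}

theorem add_three_halves_mul_le_posSquareEnergy (huv : u ≠ v)
    (hU : G.IsIndepSet (neighborsExcept G u v)) (hW : G.IsIndepSet (neighborsExcept G v u))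
    (hp : #(privateNeighbors G u v) = p) (hq : #(privateNeighbors G v u) = q)
    (hr : #(neighborsExcept G u v ∩ neighborsExcept G v u) = r) (hp' : 0 < p) (hq' : 0 < q)
    (he : #(crossEdges G u v) ≤ r) : p + q + 3 / 2 * r ≤ G.posSquareEnergy := by
  obtain ⟨δ, τ, hδ, hτ, hδδ, hττ⟩ := exists_sq_eq_det_and_sq_eq_trace (Nat.cast_pos.mpr hp')
    (Nat.cast_pos.mpr hq') (Nat.cast_nonneg r)
  obtain ⟨X, hX, hgain, -⟩ := exists_posSemidef_le_gain huv hU hW hp hq hr hδ hτ hδδ hττ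
  have hcross : 4 * (#(crossEdges G u v) : ℝ) ≤ τ * δ := by
    rcases Nat.eq_zero_or_pos #(crossEdges G u v) with h | h
    · rw [h, Nat.cast_zero, mul_zero]
      positivity
    · have hle : #(crossEdges G u v) ≤ p * q := by
        rw [← hp, ← hq, crossEdges_eq_interedges_privateNeighbors hU hW]
        exact G.card_interedges_le_mul _ _
      exact four_mul_le_mul_of_sq_eq (Nat.cast_nonneg p) (Nat.cast_nonneg q)
        (by exact_mod_cast h) (by exact_mod_cast he) (by exact_mod_cast hle) hδ hτ hδδ hττ
  have hloss : 2 * r / (τ * δ) * #(crossEdges G u v) ≤ r / 2 := by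
    rw [div_mul_eq_mul_div, div_le_iff₀ (by positivity)]
    linarith [mul_le_mul_of_nonneg_left hcross (Nat.cast_nonneg (α := ℝ) r)]
  linarith [gain_le_posSquareEnergy (G := G) hX]

theorem add_two_le_posSquareEnergy (huv : u ≠ v)
    (hU : G.IsIndepSet (neighborsExcept G u v)) (hW : G.IsIndepSet (neighborsExcept G v u))
    (hp : #(privateNeighbors G u v) = p) (hq : #(privateNeighbors G v u) = q)
    (hr : #(neighborsExcept G u v ∩ neighborsExcept G v u) = 1) (hp' : 0 < p) (hq' : 0 < q)
    (he : #(crossEdges G u v) ≤ 1) : (p : ℝ) + q + 2 ≤ G.posSquareEnergy := by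
  obtain ⟨δ, τ, hδ, hτ, hδδ, hττ⟩ := exists_sq_eq_det_and_sq_eq_trace (Nat.cast_pos.mpr hp')
    (Nat.cast_pos.mpr hq') (Nat.cast_nonneg 1)
  obtain ⟨X, hX, hgain, hentry⟩ := exists_posSemidef_le_gain huv hU hW hp hq hr hδ hτ hδδ hττ
  rw [Nat.cast_one] at hδδ hττ hgain
  rcases Nat.le_one_iff_eq_zero_or_eq_one.mp he with he | he
  · rw [he, Nat.cast_zero, mul_zero] at hgain
    linarith [gain_le_posSquareEnergy (G := G) hX]
  · obtain ⟨⟨x, y⟩, hxy⟩ := card_pos.mp (he ▸ one_pos)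
    rw [crossEdges_eq_interedges_privateNeighbors hU hW] at hxy
    obtain ⟨hx, hy, hadj⟩ := G.mk_mem_interedges_iff.mp hxy
    obtain ⟨ht, htt⟩ := two_div_mul_le_sq_of_sq_eq (Nat.one_le_cast.mpr hp')
      (Nat.one_le_cast.mpr hq') hδ hτ (by linarith) (by linarith)
    have hle := gain_add_sq_le_posSquareEnergy hX hadj ht (by
      rw [hentry x hx y hy]
      field_simp
      ring)
    rw [he, Nat.cast_one, mul_one, mul_one] at hgain
    linarith

theorem privateNeighbors_nonempty_of_adj (hdom : IsDominatingPair G u v) (hadj : G.Adj u v)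
    (hv : ¬G.IsDominatingVertex v) : (privateNeighbors G u v).Nonempty := by
  simp only [IsDominatingVertex, not_forall] at hv
  obtain ⟨w, hwv, hvw⟩ := hv
  have hwu : w ≠ u := fun h => hvw (h ▸ hadj.symm)
  exact ⟨w, mem_privateNeighbors.mpr
    ⟨mem_neighborsExcept.mpr ⟨hwv, (hdom w hwu hwv).resolve_right hvw⟩,
      fun h => hvw (adj_of_mem_neighborsExcept h)⟩⟩

theorem card_sub_one_le_of_card_crossEdges_le (huv : u ≠ v) (hdom : IsDominatingPair G u v)
    (hU : G.IsIndepSet (neighborsExcept G u v)) (hW : G.IsIndepSet (neighborsExcept G v u))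
    (hu : (privateNeighbors G u v).Nonempty) (hv : (privateNeighbors G v u).Nonempty)
    (hinter : (neighborsExcept G u v ∩ neighborsExcept G v u).Nonempty)
    (he : #(crossEdges G u v) ≤ #(neighborsExcept G u v ∩ neighborsExcept G v u)) :
    (Fintype.card V : ℝ) - 1 ≤ G.posSquareEnergy := by
  rw [card_eq_of_isDominatingPair huv hdom]
  push_cast
  rcases (Nat.one_le_iff_ne_zero.mpr hinter.card_ne_zero).eq_or_lt with h | h
  · have := add_two_le_posSquareEnergy huv hU hW rfl rfl h.symm hu.card_pos hv.card_pos (h ▸ he)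
    rw [← h]
    push_cast
    linarith
  · have := add_three_halves_mul_le_posSquareEnergy huv hU hW rfl rfl rfl hu.card_pos hv.card_pos he
    have : (2 : ℝ) ≤ #(neighborsExcept G u v ∩ neighborsExcept G v u) := by exact_mod_cast h
    linarith

theorem card_sub_one_le_of_adj (hdom : IsDominatingPair G u v) (hadj : G.Adj u v)
    (hu : ¬G.IsDominatingVertex u) (hv : ¬G.IsDominatingVertex v)
    (hU : G.IsIndepSet (neighborsExcept G u v)) (hW : G.IsIndepSet (neighborsExcept G v u)) :
    (Fintype.card V : ℝ) - 1 ≤ G.posSquareEnergy := by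
  rcases lt_or_ge #(crossEdges G u v) #(neighborsExcept G u v ∩ neighborsExcept G v u) with he | he
  · exact card_sub_one_le_of_card_crossEdges_le hadj.ne hdom hU hW
      (privateNeighbors_nonempty_of_adj hdom hadj hv)
      (privateNeighbors_nonempty_of_adj hdom.symm hadj.symm hu)
      (card_pos.mp (Nat.zero_lt_of_lt he)) he.le
  · have hcut := adjMatrix_add_card_le_posSquareEnergy hadj.ne hU hW
    rw [adjMatrix_apply, if_pos hadj] at hcut
    rw [card_eq_of_isDominatingPair hadj.ne hdom]
    have := Nat.cast_le (α := ℝ).mpr he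
    push_cast
    linarith

theorem card_sub_one_le_of_not_adj (hG : G.Connected) (huv : u ≠ v)
    (hdom : IsDominatingPair G u v) (hadj : ¬G.Adj u v)
    (hU : G.IsIndepSet (neighborsExcept G u v)) (hW : G.IsIndepSet (neighborsExcept G v u)) :
    (Fintype.card V : ℝ) - 1 ≤ G.posSquareEnergy := by
  have hcard := congrArg (Nat.cast (R := ℝ)) (card_eq_of_isDominatingPair huv hdom)
  push_cast at hcard
  rcases lt_or_ge #(neighborsExcept G u v ∩ neighborsExcept G v u) #(crossEdges G u v) with he | he
  · have hcut := adjMatrix_add_card_le_posSquareEnergy huv hU hW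
    rw [adjMatrix_apply, if_neg hadj] at hcut
    have := Nat.cast_le (α := ℝ).mpr (Nat.succ_le_of_lt he)
    push_cast at this
    linarith
  rcases (crossEdges G u v).eq_empty_or_nonempty with hempty | hcross
  · have hinter := (inter_nonempty_or_crossEdges_nonempty hG huv hadj hdom).resolve_right
      (not_nonempty_iff_eq_empty.mpr hempty)
    have hstars := card_neighborsExcept_add_le_posSquareEnergy huv hadj hU hW hempty
    rw [card_neighborsExcept G u v, card_neighborsExcept G v u,
      inter_comm (neighborsExcept G v u)] at hstars
    have := Nat.one_le_cast (α := ℝ).mpr hinter.card_pos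
    push_cast at hstars
    linarith
  · obtain ⟨⟨x, y⟩, hxy⟩ := id hcross
    rw [crossEdges_eq_interedges_privateNeighbors hU hW] at hxy
    obtain ⟨hx, hy, -⟩ := G.mk_mem_interedges_iff.mp hxy
    exact card_sub_one_le_of_card_crossEdges_le huv hdom hU hW ⟨x, hx⟩ ⟨y, hy⟩
      (card_pos.mp (hcross.card_pos.trans_le he)) he

theorem card_sub_one_le_of_isDominatingPair (hG : G.Connected) (huv : u ≠ v)
    (hdom : IsDominatingPair G u v) : (Fintype.card V : ℝ) - 1 ≤ G.posSquareEnergy := by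
  by_cases hu : G.IsDominatingVertex u
  · exact card_sub_one_le_of_isDominatingVertex hu
  by_cases hv : G.IsDominatingVertex v
  · exact card_sub_one_le_of_isDominatingVertex hv
  by_cases hU : G.IsIndepSet (neighborsExcept G u v)
  swap
  · exact card_sub_one_le_of_not_isIndepSet huv hdom hU
  by_cases hW : G.IsIndepSet (neighborsExcept G v u)
  swap
  · exact card_sub_one_le_of_not_isIndepSet huv.symm hdom.symm hW
  by_cases hadj : G.Adj u v
  · exact card_sub_one_le_of_adj hdom hadj hu hv hU hW
  · exact card_sub_one_le_of_not_adj hG huv hdom hadj hU hW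

end DominatingPair

end PositiveSquareEnergy

theorem theorem1p5 {V : Type*} [Fintype V] [DecidableEq V] (G : SimpleGraph V)
    [DecidableRel G.Adj] (hG : G.Connected) :
    ((∃ v, G.IsDominatingVertex v) →
        ¬ Nonempty (G ≃g completeBipartiteGraph (Fin 1) (Fin (Fintype.card V - 1))) →
        (Fintype.card V : ℝ) ≤ G.posSquareEnergy) ∧
      (G.dominationNumber ≤ 2 → (Fintype.card V : ℝ) - 1 ≤ G.posSquareEnergy) := by
  refine ⟨fun ⟨v, hv⟩ hstar => ?_, fun hγ => ?_⟩
  · by_contra! hlt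
    exact hstar (PositiveSquareEnergy.nonempty_iso_star hv fun x y hx hy hxy => hlt.not_ge
      (PositiveSquareEnergy.card_le_of_isDominatingVertex_of_adj hv hx.ne' hy.ne' hxy))
  · have := hG.nonempty
    obtain ⟨u, v, hdom⟩ :=
      PositiveSquareEnergy.exists_isDominatingPair_of_dominationNumber_le_two hγ
    rcases eq_or_ne u v with rfl | huv
    · exact PositiveSquareEnergy.card_sub_one_le_of_isDominatingVertex fun w hw =>
        or_self_iff.mp (hdom w hw hw)
    · exact PositiveSquareEnergy.card_sub_one_le_of_isDominatingPair hG huv hdom
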